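/- Let $\mathcal H=L^2(\mathbb R)$, let $Q$ be the position operator, $(Q\psi)(x)=x\psi(x)$, and $P$ the momentum operator, $(P\psi)(x)=-i\psi'(x)$ (each taken as the closure of its restriction to the Schwartz space). Let $a=\frac{1}{\sqrt2}(Q+iP)$ be the annihilation operator, let $Q_\theta$ be the closure of $\frac{1}{\sqrt2}(e^{i\theta}a^*+e^{-i\theta}a)$, and let $W(q,p)=e^{iqp/2}e^{-iqP}e^{ipQ}$ be the Weyl operators. For a self-adjoint operator $A$, $e^{itA}$ denotes the strongly continuous one-parameter unitary group with generator $A$. For $\theta\in(-\pi,0)\cup(0,\pi)$ let $f_\theta:\mathbb R^2\to\mathbb R^2$ be the linear map $f_\theta(q,p)=(q,\,q\cos\theta+p\sin\theta)$. Then the following hold. 1. The operators $Q$, $P$ and $Q_\theta$ are self-adjoint and generate the unitary groups $e^{itQ}$, $e^{itP}$, $e^{itQ_\theta}$; moreover $Q_0=Q$. The map $f_\theta$ is a bijection, so that $W_\theta(q,p):=W(f_\theta^{-1}(q,p))$ is well defined. 2. For all $q,p\in\mathbb R$, $$W_\theta(q,p)=e^{\frac{i}{2}\frac{qp}{\sin\theta}}\,e^{-\frac{iq}{\sin\theta}Q_\theta}\,e^{\frac{ip}{\sin\theta}Q}.$$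 3. The map $(q,p)\mapsto W_\theta(q,p)$ is a strongly continuous, irreducible projective unitary representation of $\mathbb R^2$ on $\mathcal H$ (irreducible: the only closed invariant subspaces are $\{0\}$ and $\mathcal H$), and for all $(q,p),(q',p')\in\mathbb R^2$, $$W_\theta(q+q',p+p')=e^{\frac{i}{2}\frac{qp'-pq'}{\sin\theta}}\,W_\theta(q,p)\,W_\theta(q',p').$$ 4. There is a unitary operator $V$ on $\mathcal H$ with $V\,W(q,p)=W_\theta(q,p)\,V$ for all $(q,p)\in\mathbb R^2$ if and only if $\theta=\frac{\pi}{2}$. The same holds for equivalence up to phases: there are a unitary $V$ and numbers $c(q,p)\in\mathbb C$ of modulus one with $V\,W(q,p)=c(q,p)\,W_\theta(q,p)\,V$ for all $(q,p)$ if and only if $\theta=\frac{\pi}{2}$. -/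

import Mathlib

open scoped SchwartzMap

noncomputable section

namespace TiltedWeyl

/-! ### One-parameter unitary groups and the exponential `e^{itA}` -/

section Stone

variable {E : Type*} [NormedAddCommGroup E] [InnerProductSpace ℂ E] [CompleteSpace E]

/-- `U` is a strongly continuous one-parameter unitary group whose infinitesimal generator is
exactly the (possibly unbounded) operator `A`: a vector `ψ` lies in the domain of `A` with
`A ψ = φ` if and only if `(U t ψ - ψ) / t → i φ` as `t → 0`. For a self-adjoint `A` this is the
characterization of `U t = e^{itA}` by Stone's theorem. -/
structure IsUnitaryGroupOf (A : E →ₗ.[ℂ] E) (U : ℝ → E →L[ℂ] E) : Prop where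
  unitary : ∀ t, U t ∈ unitary (E →L[ℂ] E)
  zero : U 0 = 1
  add : ∀ s t, U (s + t) = U s * U t
  continuous : ∀ ψ, Continuous fun t => U t ψ
  generator : ∀ ψ φ, (ψ, φ) ∈ A.graph ↔
    Filter.Tendsto (fun t : ℝ => (t : ℂ)⁻¹ • (U t ψ - ψ)) (nhdsWithin 0 {0}ᶜ)
      (nhds (Complex.I • φ))

open Classical in
/-- `expI A t` is the operator `e^{itA}`, that is, the unitary group generated by `A` at time `t`
(the group is unique for densely defined `A`, see `IsUnitaryGroupOf.unique`). If `A` generates no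
unitary group, the value is `0`. -/
def expI (A : E →ₗ.[ℂ] E) (t : ℝ) : E →L[ℂ] E :=
  if h : ∃ U : ℝ → E →L[ℂ] E, IsUnitaryGroupOf A U then h.choose t else 0

theorem IsUnitaryGroupOf.hasDerivAt {A : E →ₗ.[ℂ] E} {U : ℝ → E →L[ℂ] E}
    (hU : IsUnitaryGroupOf A U) {ψ φ : E} (h : (ψ, φ) ∈ A.graph) (t : ℝ) :
    HasDerivAt (fun s : ℝ => U s ψ) (U t (Complex.I • φ)) t := by
  rw [hasDerivAt_iff_tendsto_slope_zero]
  have h1 := ((U t).continuous.tendsto _).comp ((hU.generator ψ φ).1 h)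
  refine h1.congr fun s => ?_
  have : (s⁻¹ : ℝ) • (U (t + s) ψ - U t ψ) = ((s⁻¹ : ℝ) : ℂ) • (U (t + s) ψ - U t ψ) :=
    (Complex.coe_smul _ _).symm
  rw [this, hU.add]
  simp

theorem IsUnitaryGroupOf.inner_eq {A : E →ₗ.[ℂ] E} {U : ℝ → E →L[ℂ] E}
    (hU : IsUnitaryGroupOf A U) (t : ℝ) (x y : E) :
    inner ℂ (U t x) (U t y) = inner ℂ x y := by
  have h := (Unitary.mem_iff.1 (hU.unitary t)).1
  rw [← ContinuousLinearMap.adjoint_inner_right, ← ContinuousLinearMap.star_eq_adjoint,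
    ← mul_apply_eq_comp, h, one_apply_eq_self]

theorem IsUnitaryGroupOf.symmetric {A : E →ₗ.[ℂ] E} {U : ℝ → E →L[ℂ] E}
    (hU : IsUnitaryGroupOf A U) {x y z w : E} (hx : (x, y) ∈ A.graph) (hz : (z, w) ∈ A.graph) :
    inner ℂ (Complex.I • y) z + inner ℂ x (Complex.I • w) = 0 := by
  have h := (hU.hasDerivAt hx 0).inner ℂ (hU.hasDerivAt hz 0)
  simp only [hU.inner_eq] at h
  have h' := h.unique (hasDerivAt_const (0 : ℝ) (inner ℂ x z))
  rw [add_comm]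
  exact h'

theorem IsUnitaryGroupOf.mem_graph {A : E →ₗ.[ℂ] E} {U : ℝ → E →L[ℂ] E}
    (hU : IsUnitaryGroupOf A U) {x y : E} (hx : (x, y) ∈ A.graph) (t : ℝ) :
    (U t x, U t y) ∈ A.graph := by
  rw [hU.generator]
  have h1 := ((U t).continuous.tendsto _).comp ((hU.generator x y).1 hx)
  simp only [map_smul] at h1
  refine h1.congr fun s => ?_
  have h2 : U s (U t x) = U t (U s x) := by
    rw [← mul_apply_eq_comp, ← mul_apply_eq_comp, ← hU.add, ← hU.add,
      add_comm]
  simp [h2]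

/-- A unitary group is determined by its generator. -/
theorem IsUnitaryGroupOf.unique {A : E →ₗ.[ℂ] E} {U V : ℝ → E →L[ℂ] E}
    (hA : Dense (A.domain : Set E)) (hU : IsUnitaryGroupOf A U) (hV : IsUnitaryGroupOf A V) :
    U = V := by
  have key : ∀ ψ φ : E, (ψ, φ) ∈ A.graph → ∀ t, U t ψ = V t ψ := by
    intro ψ φ h t
    have hd : ∀ s, HasDerivAt (fun s : ℝ => inner ℂ (U s ψ) (V s ψ)) (0 : ℂ) s := by
      intro s
      have h1 := (hU.hasDerivAt h s).inner ℂ (hV.hasDerivAt h s)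
      have h2 := hU.symmetric (hU.mem_graph h s) (hV.mem_graph h s)
      rw [add_comm, ← map_smul, ← map_smul] at h2
      rwa [h2] at h1
    have hc := is_const_of_deriv_eq_zero (fun s => (hd s).differentiableAt)
      (fun s => (hd s).deriv) t 0
    simp only [hU.zero, hV.zero, one_apply_eq_self] at hc
    have hc' : inner ℂ (V t ψ) (U t ψ) = inner ℂ ψ ψ := by
      rw [← inner_conj_symm, hc, inner_conj_symm]
    rw [← sub_eq_zero, ← inner_self_eq_zero (𝕜 := ℂ), inner_sub_left, inner_sub_right,
      inner_sub_right, hU.inner_eq, hV.inner_eq, hc, hc']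
    ring
  funext t
  refine DFunLike.coe_injective (Continuous.ext_on hA (U t).continuous (V t).continuous ?_)
  intro ψ hψ
  exact key ψ (A ⟨ψ, hψ⟩) (A.mem_graph ⟨ψ, hψ⟩) t

theorem expI_eq {A : E →ₗ.[ℂ] E} {U : ℝ → E →L[ℂ] E}
    (hA : Dense (A.domain : Set E)) (hU : IsUnitaryGroupOf A U) : expI A = U := by
  have h : ∃ U : ℝ → E →L[ℂ] E, IsUnitaryGroupOf A U := ⟨U, hU⟩
  have : expI A = h.choose := by
    funext t
    simp only [expI, dif_pos h]
  rw [this]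
  exact h.choose_spec.unique hA hU

end Stone

/-! ### Projective unitary representations -/

section Representation

variable {G : Type*} [AddCommGroup G] [TopologicalSpace G]
variable {E : Type*} [NormedAddCommGroup E] [InnerProductSpace ℂ E] [CompleteSpace E]

/-- `U` is a (strongly continuous) projective unitary representation of `G` with multiplier `m`,
in the convention `U (x + y) = m x y • (U x * U y)`. -/
structure IsProjectiveUnitaryRep (m : G → G → ℂ) (U : G → E →L[ℂ] E) : Prop where
  unitary : ∀ x, U x ∈ unitary (E →L[ℂ] E)
  norm_multiplier : ∀ x y, ‖m x y‖ = 1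
  add : ∀ x y, U (x + y) = m x y • (U x * U y)
  continuous : ∀ ψ, Continuous fun x => U x ψ

/-- The space is nonzero and has no closed invariant subspaces except `0` and itself. -/
def IsIrreducible (U : G → E →L[ℂ] E) : Prop :=
  Nontrivial E ∧ ∀ K : Submodule ℂ E, IsClosed (K : Set E) →
    (∀ x, ∀ ψ ∈ K, U x ψ ∈ K) → K = ⊥ ∨ K = ⊤

/-- `V U₁(x) = U₂(x) V` for all `x`, for some unitary `V`. -/
def UnitarilyEquivalent (U₁ U₂ : G → E →L[ℂ] E) : Prop :=
  ∃ V : E ≃ₗᵢ[ℂ] E, ∀ x ψ, V (U₁ x ψ) = U₂ x (V ψ)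

/-- `V U₁(x) = c(x) U₂(x) V` for all `x`, for some unitary `V` and phases `c(x)`. -/
def UnitarilyEquivalentUpToPhase (U₁ U₂ : G → E →L[ℂ] E) : Prop :=
  ∃ (V : E ≃ₗᵢ[ℂ] E) (c : G → ℂ), (∀ x, ‖c x‖ = 1) ∧ ∀ x ψ, V (U₁ x ψ) = c x • U₂ x (V ψ)

end Representation

/-! ### Position, momentum and quadratures on `L²(ℝ)` -/

/-- The Hilbert space `L²(ℝ)` of the signal mode, in the coordinate representation. -/
abbrev H : Type := MeasureTheory.Lp ℂ 2 (MeasureTheory.volume : MeasureTheory.Measure ℝ)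

/-- The inclusion of the Schwartz space in `L²(ℝ)`. -/
def incl : 𝓢(ℝ, ℂ) →ₗ[ℂ] H :=
  (SchwartzMap.toLpCLM ℂ ℂ 2 (MeasureTheory.volume : MeasureTheory.Measure ℝ)).toLinearMap

theorem incl_injective : Function.Injective incl :=
  SchwartzMap.injective_toLp 2 (MeasureTheory.volume : MeasureTheory.Measure ℝ)

/-- The operator in `L²(ℝ)` with the Schwartz space as its domain, on which it acts as `T`. -/
def schwartzOp (T : 𝓢(ℝ, ℂ) →ₗ[ℂ] 𝓢(ℝ, ℂ)) : H →ₗ.[ℂ] H where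
  domain := LinearMap.range incl
  toFun := (incl ∘ₗ T) ∘ₗ (LinearEquiv.ofInjective incl incl_injective).symm.toLinearMap

/-- `f ↦ (x ↦ x f(x))` on the Schwartz space. -/
def mulX : 𝓢(ℝ, ℂ) →ₗ[ℂ] 𝓢(ℝ, ℂ) :=
  (SchwartzMap.smulLeftCLM ℂ (fun x : ℝ => (x : ℂ))).toLinearMap

theorem mulX_apply (f : 𝓢(ℝ, ℂ)) (x : ℝ) : mulX f x = x * f x := by
  have h : (fun x : ℝ => (x : ℂ)).HasTemperateGrowth := Complex.ofRealCLM.hasTemperateGrowth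
  exact SchwartzMap.smulLeftCLM_apply_apply h f x

/-- `f ↦ -i f'` on the Schwartz space. -/
def negIDeriv : 𝓢(ℝ, ℂ) →ₗ[ℂ] 𝓢(ℝ, ℂ) :=
  (-Complex.I) • (SchwartzMap.derivCLM ℂ ℂ).toLinearMap

/-- The position operator `Q`, `(Qψ)(x) = x ψ(x)`: the closure of its restriction to the Schwartz
space. -/
def position : H →ₗ.[ℂ] H := (schwartzOp mulX).closure

/-- The momentum operator `P`, `(Pψ)(x) = -i ψ'(x)`: the closure of its restriction to the Schwartz
space. -/
def momentum : H →ₗ.[ℂ] H := (schwartzOp negIDeriv).closure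

/-- The annihilation operator `a = (Q + iP) / √2`, on the intersection of the domains of `Q` and
`P`. -/
def annihilation : H →ₗ.[ℂ] H :=
  ((√2 : ℝ) : ℂ)⁻¹ • (position + Complex.I • momentum)

/-- The quadrature operator `Q_θ`, the closure of `(e^{iθ} a* + e^{-iθ} a) / √2`. -/
def quadrature (θ : ℝ) : H →ₗ.[ℂ] H :=
  (((√2 : ℝ) : ℂ)⁻¹ • (Complex.exp (Complex.I * θ) • annihilation.adjoint +
    Complex.exp (-(Complex.I * θ)) • annihilation)).closure

/-! ### Weyl operators -/

/-- The Weyl operator `W(q,p) = e^{iqp/2} e^{-iqP} e^{ipQ}`. -/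
def weyl (z : ℝ × ℝ) : H →L[ℂ] H :=
  Complex.exp (Complex.I * (z.1 * z.2 / 2)) • (expI momentum (-z.1) * expI position z.2)

/-- The linear map `f_θ(q,p) = (q, q cos θ + p sin θ)`. -/
def tilt (θ : ℝ) : ℝ × ℝ →ₗ[ℝ] ℝ × ℝ where
  toFun z := (z.1, z.1 * Real.cos θ + z.2 * Real.sin θ)
  map_add' z w := by ext <;> simp; ring
  map_smul' c z := by ext <;> simp; ring

/-- The tilted Weyl operator `W_θ(q,p) = W(f_θ⁻¹(q,p))`; `f_θ` is bijective if `sin θ ≠ 0`. -/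
def tiltedWeyl (θ : ℝ) (z : ℝ × ℝ) : H →L[ℂ] H :=
  weyl (Function.invFun (tilt θ) z)

/-- `m_θ((q,p),(q',p')) = e^{i(qp' - pq')/(2 sin θ)}`. -/
def tiltedMultiplier (θ : ℝ) (z w : ℝ × ℝ) : ℂ :=
  Complex.exp (Complex.I * ((z.1 * w.2 - z.2 * w.1) / (2 * Real.sin θ)))

end TiltedWeyl

end

/-!
On Schwartz functions the displacements `(D(q,p)ψ)(x) = e^{i(px - qp/2)} ψ(x - q)` along the ray
`t ↦ t(-s, c)` form a one-parameter group with derivative `i(cQ + sP)`. They preserve the Schwartz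
space, so by Nelson's criterion it is a core of the generator, and the closure of `cQ + sP` is
self-adjoint with unitary group `t ↦ D(t(-s, c))`. The operator `(e^{iθ}a* + e^{-iθ}a)/√2` is a
symmetric extension of `cos θ Q + sin θ P` on Schwartz space, hence has the same closure. All
exponentials are therefore displacements, `W = D`, and `W_θ = D ∘ f_θ⁻¹`; the explicit form and the
multiplier of `W_θ` are read off from `D(z + w) = e^{iσ(z,w)/2} D(z) D(w)`, where
`σ((q,p),(q',p')) = qp' - pq'`.

If `φ` is orthogonal to `D(q,p)ψ` for all `q, p`, then for each `q` the Fourier transform of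
`conj φ · ψ(· - q)` vanishes; integrating `|φ(x)| |ψ(x - q)|` over `x` and `q` gives `φ = 0` or
`ψ = 0`, which is irreducibility. Finally, the scalar by which two operators of a projective
representation fail to commute is unchanged by intertwiners and phases. It is `e^{-iσ(z,w)}` for
`W` and `e^{-iσ(z,w)/sin θ}` for `W_θ`, and these agree only if `sin θ = 1`.
-/

open scoped InnerProductSpace

noncomputable section

namespace TiltedWeyl

section Adjoint

open LinearPMap

variable {𝕜 E F : Type*} [RCLike 𝕜] [NormedAddCommGroup E] [InnerProductSpace 𝕜 E]
  [NormedAddCommGroup F] [InnerProductSpace 𝕜 F]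

theorem isClosed_adjoint_relation (g : Submodule 𝕜 (E × F)) :
    IsClosed (g.adjoint : Set (F × E)) := by
  have hg : (g.adjoint : Set (F × E)) =
      ⋂ z ∈ g, {x | inner 𝕜 z.2 x.1 - inner 𝕜 z.1 x.2 = 0} := by
    ext x
    simp [Submodule.mem_adjoint_iff]
  rw [hg]
  exact isClosed_biInter fun z _ => isClosed_eq (by fun_prop) continuous_const

theorem adjoint_relation_anti {g h : Submodule 𝕜 (E × F)} (hgh : g ≤ h) :
    h.adjoint ≤ g.adjoint := by
  intro x hx
  rw [Submodule.mem_adjoint_iff] at hx ⊢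
  exact fun a b hab => hx a b (hgh hab)

theorem le_adjoint_adjoint_relation (g : Submodule 𝕜 (E × F)) : g ≤ g.adjoint.adjoint := by
  intro x hx
  rw [Submodule.mem_adjoint_iff]
  intro a b hab
  have h := congrArg (starRingEnd 𝕜) ((Submodule.mem_adjoint_iff _ _).1 hab x.1 x.2 hx)
  simp only [_root_.map_sub, inner_conj_symm, _root_.map_zero] at h
  linear_combination -h

theorem adjoint_adjoint_relation [CompleteSpace E] [CompleteSpace F] (g : Submodule 𝕜 (E × F)) :
    g.adjoint.adjoint = g.topologicalClosure := by
  refine le_antisymm (fun x hx => ?_)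
    (g.topologicalClosure_minimal (le_adjoint_adjoint_relation g) (isClosed_adjoint_relation _))
  let g' : Submodule 𝕜 (WithLp 2 (E × F)) := g.map (WithLp.linearEquiv 2 𝕜 (E × F)).symm.toLinearMap
  -- The adjoint is the orthogonal complement in the Hilbert sum, rotated by `(b, a) ↦ (-a, b)`.
  have hx' : WithLp.toLp 2 x ∈ g'ᗮᗮ := by
    rw [Submodule.mem_orthogonal]
    intro u hu
    have hrot : (-(WithLp.ofLp u).2, (WithLp.ofLp u).1) ∈ g.adjoint := by
      rw [Submodule.mem_adjoint_iff]
      intro a b hab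
      have hab' := (Submodule.mem_orthogonal _ _).1 hu (WithLp.toLp 2 (a, b)) ⟨(a, b), hab, rfl⟩
      simp only [WithLp.prod_inner_apply] at hab'
      simp only [inner_neg_right]
      linear_combination -hab'
    have hux := (Submodule.mem_adjoint_iff _ _).1 hx _ _ hrot
    simp only [inner_neg_left] at hux
    simp only [WithLp.prod_inner_apply]
    linear_combination hux
  rw [Submodule.orthogonal_orthogonal_eq_closure] at hx'
  have hcl : WithLp.toLp 2 x ∈ closure (g' : Set (WithLp 2 (E × F))) := hx'
  refine closure_mono ?_ (image_closure_subset_closure_image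
    (WithLp.prod_continuous_ofLp 2 E F) ⟨_, hcl, rfl⟩)
  rintro _ ⟨_, ⟨y, hy, rfl⟩, rfl⟩
  exact hy

variable [CompleteSpace E] {A B : E →ₗ.[𝕜] F}

theorem adjoint_anti (hA : Dense (A.domain : Set E)) (hAB : A ≤ B) : B.adjoint ≤ A.adjoint := by
  refine le_of_le_graph ?_
  rw [adjoint_graph_eq_graph_adjoint hA, adjoint_graph_eq_graph_adjoint (hA.mono hAB.1)]
  exact adjoint_relation_anti (le_graph_of_le hAB)

variable [CompleteSpace F]

theorem adjoint_adjoint_eq_closure (hA : Dense (A.domain : Set E))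
    (hA' : Dense (A.adjoint.domain : Set F)) : A.adjoint.adjoint = A.closure := by
  have hle : A ≤ A.adjoint.adjoint :=
    (adjoint_isFormalAdjoint hA).le_adjoint hA'
  have hcl : A.IsClosable := (adjoint_isClosed hA').isClosable.leIsClosable hle
  refine eq_of_eq_graph ?_
  rw [← hcl.graph_closure_eq_closure_graph, adjoint_graph_eq_graph_adjoint hA',
    adjoint_graph_eq_graph_adjoint hA, adjoint_adjoint_relation]

end Adjoint

section EssentiallySelfAdjoint

open LinearPMap

variable {𝕜 E : Type*} [RCLike 𝕜] [NormedAddCommGroup E] [InnerProductSpace 𝕜 E] [CompleteSpace E]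
  {C S A : E →ₗ.[𝕜] E}

theorem closure_eq_of_le_of_isFormalAdjoint (hC : Dense (C.domain : Set E))
    (hsa : IsSelfAdjoint C.closure) (hle : C ≤ S) (hS : S.IsFormalAdjoint S) :
    S.closure = C.closure := by
  have hSd : Dense (S.domain : Set E) := hC.mono hle.1
  have hS1 : S ≤ S.adjoint := hS.le_adjoint hSd
  have hS1d : Dense (S.adjoint.domain : Set E) := hSd.mono hS1.1
  have hcl : S.adjoint.adjoint = S.closure := adjoint_adjoint_eq_closure hSd hS1d
  have hCS : C.closure ≤ S.closure :=
    ((adjoint_isClosed hSd).isClosable.leIsClosable hS1).closure_mono hle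
  have hsymm : S.closure ≤ S.closure.adjoint := by
    have hScl : Dense (S.adjoint.adjoint.domain : Set E) := hcl ▸ hSd.mono S.le_closure.1
    rw [← hcl]
    exact adjoint_anti hScl (adjoint_anti hSd hS1)
  refine le_antisymm (hsymm.trans ?_) hCS
  exact (adjoint_anti hsa.dense_domain hCS).trans_eq (isSelfAdjoint_def.1 hsa)

theorem isSelfAdjoint_of_core (hC : Dense (C.domain : Set E)) (hle : C ≤ A)
    (hA : A.IsFormalAdjoint A) (hadj : C.adjoint ≤ A) : IsSelfAdjoint A ∧ C.closure = A := by
  have hAA : A ≤ A.adjoint := hA.le_adjoint (hC.mono hle.1)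
  have hCA : C.adjoint = A := le_antisymm hadj (hAA.trans (adjoint_anti hC hle))
  have hsa : A.adjoint = A := le_antisymm ((adjoint_anti hC hle).trans_eq hCA) hAA
  refine ⟨isSelfAdjoint_def.2 hsa, ?_⟩
  rw [← adjoint_adjoint_eq_closure hC (hCA ▸ hC.mono hle.1), hCA, hsa]

end EssentiallySelfAdjoint

section UnitaryGroup

open LinearPMap Filter Topology Complex

variable {E : Type*} [NormedAddCommGroup E] [InnerProductSpace ℂ E]

/-- The infinitesimal generator of a family of operators `U`, normalized so that `U t = e^{itA}`
has generator `A`; its domain is the set of vectors along which `U` is differentiable at `0`. -/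
def generator (U : ℝ → E →L[ℂ] E) : E →ₗ.[ℂ] E :=
  Submodule.toLinearPMap
    { carrier := {x | HasDerivAt (fun t => U t x.1) (I • x.2) 0}
      add_mem' := fun {x y} hx hy => by simpa using hx.fun_add hy
      zero_mem' := by simpa using hasDerivAt_const (0 : ℝ) (0 : E)
      smul_mem' := fun c x hx => by simpa [smul_comm I c] using hx.fun_const_smul c }

theorem mem_graph_generator {U : ℝ → E →L[ℂ] E} {ψ φ : E} :
    (ψ, φ) ∈ (generator U).graph ↔ HasDerivAt (fun t => U t ψ) (I • φ) 0 := by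
  rw [generator, Submodule.toLinearPMap_graph_eq]
  · rfl
  · rintro ⟨ψ, φ⟩ hφ (rfl : ψ = 0)
    have h0 : HasDerivAt (fun t => U t 0) (I • φ) 0 := hφ
    simp only [_root_.map_zero] at h0
    simpa using h0.unique (hasDerivAt_const 0 0)

theorem hasDerivAt_zero_iff_tendsto {U : ℝ → E →L[ℂ] E} (h0 : U 0 = 1) {ψ φ : E} :
    HasDerivAt (fun t => U t ψ) φ 0 ↔
      Tendsto (fun t : ℝ => (t : ℂ)⁻¹ • (U t ψ - ψ)) (𝓝[≠] 0) (𝓝 φ) := by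
  rw [hasDerivAt_iff_tendsto_slope_zero]
  simp only [zero_add, h0, one_apply_eq_self, ← ofReal_inv, Complex.coe_smul]

theorem hasDerivAt_of_hasDerivAt_inner [CompleteSpace E] {D : Set E} (hD : Dense D) {u v : ℝ → E}
    (hv : Continuous v)
    (h : ∀ ψ ∈ D, ∀ t, HasDerivAt (fun t => ⟪ψ, u t⟫_ℂ) ⟪ψ, v t⟫_ℂ t) (t : ℝ) :
    HasDerivAt u (v t) t := by
  have hint : ∀ t, HasDerivAt (fun t => ∫ s in (0 : ℝ)..t, v s) (v t) t := fun t =>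
    intervalIntegral.integral_hasDerivAt_right (hv.intervalIntegrable _ _)
      hv.stronglyMeasurable.stronglyMeasurableAtFilter hv.continuousAt
  have hu : u = fun t => u 0 + ∫ s in (0 : ℝ)..t, v s := by
    funext t
    refine hD.eq_of_inner_right ℂ fun ψ hψ => ?_
    have hd : ∀ t, HasDerivAt (fun t => ⟪ψ, u t - ∫ s in (0 : ℝ)..t, v s⟫_ℂ) 0 t := fun t => by
      simpa [inner_sub_right] using
        (h ψ hψ t).fun_sub ((hasDerivAt_const t ψ).inner ℂ (hint t))
    have hconst := is_const_of_deriv_eq_zero (fun s => (hd s).differentiableAt)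
      (fun s => (hd s).deriv) t 0
    simp only [intervalIntegral.integral_same, sub_zero, inner_sub_right] at hconst
    rw [inner_add_right, ← hconst, sub_add_cancel]
  rw [hu]
  exact (hint t).const_add _

variable [CompleteSpace E] {A C : E →ₗ.[ℂ] E} {U : ℝ → E →L[ℂ] E}

theorem isUnitaryGroupOf_generator (hunitary : ∀ t, U t ∈ unitary (E →L[ℂ] E)) (h0 : U 0 = 1)
    (hadd : ∀ s t, U (s + t) = U s * U t) (hcont : ∀ ψ, Continuous fun t => U t ψ) :
    IsUnitaryGroupOf (generator U) U :=
  ⟨hunitary, h0, hadd, hcont, fun _ _ => mem_graph_generator.trans (hasDerivAt_zero_iff_tendsto h0)⟩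

theorem IsUnitaryGroupOf.mem_graph_iff (hU : IsUnitaryGroupOf A U) {ψ φ : E} :
    (ψ, φ) ∈ A.graph ↔ HasDerivAt (fun t => U t ψ) (I • φ) 0 :=
  (hU.generator ψ φ).trans (hasDerivAt_zero_iff_tendsto hU.zero).symm

theorem IsUnitaryGroupOf.inner_apply_right (hU : IsUnitaryGroupOf A U) (t : ℝ) (x y : E) :
    ⟪x, U t y⟫_ℂ = ⟪U (-t) x, y⟫_ℂ := by
  rw [← hU.inner_eq t (U (-t) x) y, ← mul_apply_eq_comp, ← hU.add, add_neg_cancel, hU.zero,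
    one_apply_eq_self]

theorem IsUnitaryGroupOf.isFormalAdjoint (hU : IsUnitaryGroupOf A U) : A.IsFormalAdjoint A := by
  intro x y
  have h := hU.symmetric (A.mem_graph x) (A.mem_graph y)
  rw [inner_smul_left, inner_smul_right, conj_I] at h
  exact mul_left_cancel₀ I_ne_zero (by linear_combination -h)

theorem IsUnitaryGroupOf.apply_mem_graph_of_le (hU : IsUnitaryGroupOf A U) (hle : C ≤ A)
    (hinv : ∀ t, ∀ ψ ∈ C.domain, U t ψ ∈ C.domain) (t : ℝ) (ψ : C.domain) :
    (U t ψ, U t (C ψ)) ∈ C.graph := by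
  have hmem := hU.mem_graph (le_graph_of_le hle (C.mem_graph ψ)) t
  have hC := C.mem_graph ⟨U t ψ, hinv t ψ ψ.2⟩
  rwa [A.mem_graph_snd_inj hmem (le_graph_of_le hle hC) rfl]

/-- For `φ` in the domain of `C†`, the orbit of `φ` is differentiable against the invariant dense
set `C.domain`; integrating this weak derivative shows that the orbit is differentiable in norm. -/
theorem IsUnitaryGroupOf.adjoint_le (hU : IsUnitaryGroupOf A U) (hC : Dense (C.domain : Set E))
    (hle : C ≤ A) (hinv : ∀ t, ∀ ψ ∈ C.domain, U t ψ ∈ C.domain) : C.adjoint ≤ A := by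
  refine le_of_le_graph ?_
  rintro ⟨φ, χ⟩ hφ
  rw [adjoint_graph_eq_graph_adjoint hC, Submodule.mem_adjoint_iff] at hφ
  have hweak : ∀ ψ ∈ C.domain, ∀ t,
      HasDerivAt (fun t => ⟪ψ, U t φ⟫_ℂ) ⟪ψ, U t (I • χ)⟫_ℂ t := by
    intro ψ hψ t
    have hψA := le_graph_of_le hle (C.mem_graph ⟨ψ, hψ⟩)
    have hd := ((hU.hasDerivAt hψA (-t)).scomp t (hasDerivAt_neg t)).inner ℂ
      (hasDerivAt_const t φ)
    have hadj := hφ _ _ (hU.apply_mem_graph_of_le hle hinv (-t) ⟨ψ, hψ⟩)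
    simp only [Function.comp_def, inner_zero_right, _root_.map_smul, neg_smul, one_smul,
      inner_neg_left, inner_smul_left, conj_I, zero_add] at hd
    simp only [hU.inner_apply_right, inner_smul_right]
    convert! hd using 1
    linear_combination -I * hadj
  have h0 := hasDerivAt_of_hasDerivAt_inner hC (hU.continuous (I • χ)) hweak 0
  rw [hU.zero, one_apply_eq_self] at h0
  exact hU.mem_graph_iff.2 h0

theorem IsUnitaryGroupOf.isSelfAdjoint_and_closure_eq (hU : IsUnitaryGroupOf A U)
    (hC : Dense (C.domain : Set E)) (hle : C ≤ A)
    (hinv : ∀ t, ∀ ψ ∈ C.domain, U t ψ ∈ C.domain) : IsSelfAdjoint A ∧ C.closure = A :=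
  isSelfAdjoint_of_core hC hle hU.isFormalAdjoint (hU.adjoint_le hC hle hinv)

end UnitaryGroup

section CircleSMul

open MeasureTheory Filter Topology

theorem continuous_apply_of_isometry {X 𝕜 E F : Type*} [TopologicalSpace X] [NormedField 𝕜]
    [SeminormedAddCommGroup E] [NormedSpace 𝕜 E] [SeminormedAddCommGroup F] [NormedSpace 𝕜 F]
    {L : X → E →ₗᵢ[𝕜] F} (hL : ∀ v, Continuous fun z => L z v) {g : X → E} (hg : Continuous g) :
    Continuous fun z => L z (g z) := by
  refine continuous_iff_continuousAt.2 fun z₀ => ?_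
  have hdist : Tendsto (fun z => dist (L z (g z)) (L z (g z₀))) (𝓝 z₀) (𝓝 0) := by
    simpa only [LinearIsometry.dist_map] using tendsto_iff_dist_tendsto_zero.1 (hg.tendsto z₀)
  exact tendsto_of_tendsto_of_dist ((hL (g z₀)).tendsto z₀) (by simpa only [dist_comm] using hdist)

theorem continuous_isometry_of_inner {X 𝕜 E F : Type*} [TopologicalSpace X] [RCLike 𝕜]
    [SeminormedAddCommGroup E] [NormedSpace 𝕜 E] [SeminormedAddCommGroup F] [InnerProductSpace 𝕜 F]
    {L : X → E →ₗᵢ[𝕜] F} {v : E} (hL : ∀ w, Continuous fun z => ⟪w, L z v⟫_𝕜) :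
    Continuous fun z => L z v := by
  refine continuous_iff_continuousAt.2 fun z₀ => ?_
  have hsq : ∀ z, ‖L z v - L z₀ v‖ = √(2 * ‖v‖ ^ 2 - 2 * RCLike.re ⟪L z₀ v, L z v⟫_𝕜) := by
    intro z
    rw [← Real.sqrt_sq (norm_nonneg (L z v - L z₀ v)), norm_sub_sq (𝕜 := 𝕜), inner_re_symm,
      LinearIsometry.norm_map, LinearIsometry.norm_map]
    ring_nf
  have hcont : Continuous fun z => √(2 * ‖v‖ ^ 2 - 2 * RCLike.re ⟪L z₀ v, L z v⟫_𝕜) :=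
    (continuous_const.sub
      (continuous_const.mul (RCLike.continuous_re.comp (hL (L z₀ v))))).sqrt
  refine tendsto_iff_norm_sub_tendsto_zero.2 ?_
  simpa [← hsq] using hcont.tendsto z₀

variable {α E : Type*} [TopologicalSpace α] [MeasurableSpace α] [OpensMeasurableSpace α]
  {μ : Measure α} [NormedAddCommGroup E]

section Isometry

variable [NormedSpace ℂ E] {p : ENNReal}

theorem memLp_circle_smul {f : α → E} (hf : MemLp f p μ) (u : C(α, Circle)) :
    MemLp (fun x => (u x : ℂ) • f x) p μ := by
  have hu : Measurable fun x => (u x : ℂ) :=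
    (Continuous.comp continuous_subtype_val u.continuous).measurable
  refine hf.of_le (hu.aestronglyMeasurable.smul hf.1) (ae_of_all _ fun x => ?_)
  simp [norm_smul, Circle.norm_coe]

variable [Fact (1 ≤ p)]

/-- Multiplication by a continuous function with values in the unit circle, as an isometry of
`L^p`. -/
def circleSMul (u : C(α, Circle)) : Lp E p μ →ₗᵢ[ℂ] Lp E p μ where
  toFun f := (memLp_circle_smul (Lp.memLp f) u).toLp _
  map_add' f g := by
    rw [← MemLp.toLp_add]
    refine MemLp.toLp_congr _ _ ?_
    filter_upwards [Lp.coeFn_add f g] with x hx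
    rw [hx, Pi.add_apply, smul_add]
    rfl
  map_smul' c f := by
    rw [RingHom.id_apply, ← MemLp.toLp_const_smul]
    refine MemLp.toLp_congr _ _ ?_
    filter_upwards [Lp.coeFn_smul c f] with x hx
    rw [hx, Pi.smul_apply, Pi.smul_apply, smul_comm]
  norm_map' f := by
    change ‖(memLp_circle_smul (Lp.memLp f) u).toLp _‖ = ‖f‖
    rw [Lp.norm_toLp, Lp.norm_def]
    congr 1
    refine eLpNorm_congr_norm_ae (ae_of_all _ fun x => ?_)
    simp [norm_smul, Circle.norm_coe]

theorem coeFn_circleSMul (u : C(α, Circle)) (f : Lp E p μ) :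
    circleSMul u f =ᵐ[μ] fun x => (u x : ℂ) • f x :=
  (memLp_circle_smul (Lp.memLp f) u).coeFn_toLp

end Isometry

theorem continuous_circleSMul [InnerProductSpace ℂ E] {X : Type*} [TopologicalSpace X]
    [FirstCountableTopology X] {u : X → C(α, Circle)} (hu : ∀ x, Continuous fun z => u z x)
    (f : Lp E 2 μ) : Continuous fun z => circleSMul (u z) f := by
  refine continuous_isometry_of_inner fun g => ?_
  have hinner : ∀ z, (fun x => ⟪g x, circleSMul (u z) f x⟫_ℂ) =ᵐ[μ]
      fun x => u z x * ⟪g x, f x⟫_ℂ := fun z => by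
    filter_upwards [coeFn_circleSMul (u z) f] with x hx
    rw [hx, inner_smul_right]
  simp only [L2.inner_def, integral_congr_ae (hinner _)]
  refine continuous_of_dominated (bound := fun x => ‖⟪g x, f x⟫_ℂ‖) (fun z => ?_)
    (fun z => ae_of_all _ fun x => by simp [Circle.norm_coe]) (L2.integrable_inner g f).norm
    (ae_of_all _ fun x => ?_)
  · exact (L2.integrable_inner g (circleSMul (u z) f)).1.congr (hinner z)
  · exact (Continuous.comp continuous_subtype_val (hu x)).mul continuous_const

end CircleSMul

section Displacement

open MeasureTheory

/-- The phase `e^{i(px - qp/2)}` of the displacement by `z = (q, p)`. -/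
def phase (z : ℝ × ℝ) : C(ℝ, Circle) where
  toFun x := Circle.exp (z.2 * x - z.1 * z.2 / 2)

theorem phase_apply (z : ℝ × ℝ) (x : ℝ) :
    (phase z x : ℂ) = Complex.exp (Complex.I * (z.2 * x - z.1 * z.2 / 2)) := by
  rw [phase, ContinuousMap.coe_mk, Circle.coe_exp, mul_comm]
  push_cast
  rfl

theorem phase_zero (x : ℝ) : phase 0 x = 1 := by simp [phase]

/-- The translation `ψ ↦ ψ(· - q)`. -/
def translation (q : ℝ) : H →ₗᵢ[ℂ] H :=
  Lp.compMeasurePreservingₗᵢ ℂ (fun x : ℝ => x - q) (measurePreserving_sub_right volume q)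

theorem coeFn_translation (q : ℝ) (ψ : H) : translation q ψ =ᵐ[volume] fun x => ψ (x - q) :=
  Lp.coeFn_compMeasurePreserving ψ (measurePreserving_sub_right volume q)

theorem continuous_translation (ψ : H) : Continuous fun q => translation q ψ := by
  let shift (q : ℝ) : C(ℝ, ℝ) := ⟨fun x => x - q, continuous_sub_right q⟩
  have hshift : Continuous shift :=
    ContinuousMap.continuous_of_continuous_uncurry _ (continuous_snd.sub continuous_fst)
  have hpres : ∀ q, MeasurePreserving (shift q) := measurePreserving_sub_right volume
  exact (continuous_const (y := ψ)).compMeasurePreservingLp hshift hpres ENNReal.ofNat_ne_top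

/-- The displacement operator `(D(q,p)ψ)(x) = e^{i(px - qp/2)} ψ(x - q)`, as an isometry. -/
def displacementIsometry (z : ℝ × ℝ) : H →ₗᵢ[ℂ] H :=
  (circleSMul (phase z)).comp (translation z.1)

/-- The displacement operator `(D(q,p)ψ)(x) = e^{i(px - qp/2)} ψ(x - q)`. -/
def displacement (z : ℝ × ℝ) : H →L[ℂ] H := (displacementIsometry z).toContinuousLinearMap

theorem coeFn_displacement (z : ℝ × ℝ) (ψ : H) :
    displacement z ψ =ᵐ[volume] fun x => phase z x * ψ (x - z.1) := by
  filter_upwards [coeFn_circleSMul (phase z) (translation z.1 ψ), coeFn_translation z.1 ψ]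
    with x hphase htranslation
  rw [← htranslation]
  exact hphase

theorem continuous_displacement (ψ : H) : Continuous fun z => displacement z ψ :=
  continuous_apply_of_isometry (L := fun z => circleSMul (phase z))
    (continuous_circleSMul (u := phase) fun x => Circle.exp.continuous.comp (by fun_prop))
    ((continuous_translation ψ).comp continuous_fst)

/-- The multiplier `e^{i(qp' - pq')/2}` of the Weyl operators. -/
def weylMultiplier (z w : ℝ × ℝ) : ℂ :=
  Complex.exp (Complex.I * ((z.1 * w.2 - z.2 * w.1) / 2))

theorem norm_weylMultiplier (z w : ℝ × ℝ) : ‖weylMultiplier z w‖ = 1 := by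
  simp [weylMultiplier, Complex.norm_exp]

theorem weylMultiplier_of_parallel {z w : ℝ × ℝ} (h : z.1 * w.2 = z.2 * w.1) :
    weylMultiplier z w = 1 := by
  have hsub : (z.1 * w.2 - z.2 * w.1 : ℂ) = 0 := sub_eq_zero.2 (by exact_mod_cast h)
  simp [weylMultiplier, hsub]

theorem phase_add (z w : ℝ × ℝ) (x : ℝ) :
    (phase (z + w) x : ℂ) = weylMultiplier z w * (phase z x * phase w (x - z.1)) := by
  simp only [phase_apply, weylMultiplier, ← Complex.exp_add, Prod.fst_add, Prod.snd_add]
  push_cast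
  ring_nf

theorem displacement_zero : displacement 0 = 1 := by
  ext1 ψ
  refine Lp.ext ?_
  filter_upwards [coeFn_displacement 0 ψ] with x hx
  simp [hx, phase_zero]

theorem displacement_add (z w : ℝ × ℝ) :
    displacement (z + w) = weylMultiplier z w • (displacement z * displacement w) := by
  ext1 ψ
  refine Lp.ext ?_
  rw [smul_apply, mul_apply_eq_comp]
  filter_upwards [coeFn_displacement (z + w) ψ, coeFn_displacement z (displacement w ψ),
    (measurePreserving_sub_right volume z.1).quasiMeasurePreserving.ae (coeFn_displacement w ψ),
    Lp.coeFn_smul (weylMultiplier z w) (displacement z (displacement w ψ))] with x hzw hz hw hsmul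
  rw [hzw, hsmul, Pi.smul_apply, hz, hw, phase_add, Prod.fst_add, sub_sub, smul_eq_mul]
  ring

theorem displacement_mul_neg (z : ℝ × ℝ) : displacement z * displacement (-z) = 1 := by
  have h := displacement_add z (-z)
  rwa [add_neg_cancel, displacement_zero, weylMultiplier_of_parallel (by simp [mul_comm]),
    one_smul, eq_comm] at h

theorem displacement_mem_unitary (z : ℝ × ℝ) : displacement z ∈ unitary (H →L[ℂ] H) := by
  have hunit : IsUnit (displacement z) :=
    ⟨⟨_, _, displacement_mul_neg z, by simpa using displacement_mul_neg (-z)⟩, rfl⟩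
  exact hunit.mem_unitary_of_star_mul_self
    ((displacement z).norm_map_iff_adjoint_comp_self.1 (displacementIsometry z).norm_map)

theorem isProjectiveUnitaryRep_displacement :
    IsProjectiveUnitaryRep weylMultiplier displacement :=
  ⟨displacement_mem_unitary, norm_weylMultiplier, displacement_add, continuous_displacement⟩

theorem hasTemperateGrowth_of_hasDerivAt_mul {f : ℝ → ℂ} {c : ℂ} {C : ℝ}
    (hf : ∀ x, HasDerivAt f (c * f x) x) (hC : ∀ x, ‖f x‖ ≤ C) : f.HasTemperateGrowth := by
  have hiter : ∀ n, iteratedDeriv n f = fun x => c ^ n * f x := by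
    intro n
    induction n with
    | zero => simp
    | succ n ih =>
      rw [iteratedDeriv_succ, ih]
      funext x
      rw [((hf x).const_mul _).deriv, pow_succ, mul_assoc]
  refine ⟨?_, fun n => ⟨0, ‖c ^ n‖ * C, fun x => ?_⟩⟩
  · refine contDiff_of_differentiable_iteratedDeriv fun n _ => ?_
    rw [hiter]
    exact fun x => (hf x).differentiableAt.const_mul _
  · rw [norm_iteratedFDeriv_eq_norm_iteratedDeriv, hiter, norm_mul, pow_zero, mul_one]
    exact mul_le_mul_of_nonneg_left (hC x) (norm_nonneg _)

theorem hasTemperateGrowth_phase (z : ℝ × ℝ) : (fun x => (phase z x : ℂ)).HasTemperateGrowth := by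
  refine hasTemperateGrowth_of_hasDerivAt_mul (c := Complex.I * z.2) (C := 1) (fun x => ?_)
    fun x => (Circle.norm_coe _).le
  simp only [phase_apply]
  have hx : HasDerivAt (fun x : ℝ => (x : ℂ)) 1 x := Complex.ofRealCLM.hasDerivAt
  refine ((((hx.const_mul (z.2 : ℂ)).sub_const (z.1 * z.2 / 2 : ℂ)).const_mul
    Complex.I).cexp).congr_deriv ?_
  ring

/-- The displacement operator on the Schwartz space. -/
def schwartzDisplacement (z : ℝ × ℝ) (f : 𝓢(ℝ, ℂ)) : 𝓢(ℝ, ℂ) :=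
  SchwartzMap.smulLeftCLM ℂ (fun x => (phase z x : ℂ)) (f.compSubConstCLM ℂ z.1)

theorem schwartzDisplacement_apply (z : ℝ × ℝ) (f : 𝓢(ℝ, ℂ)) (x : ℝ) :
    schwartzDisplacement z f x = phase z x * f (x - z.1) :=
  SchwartzMap.smulLeftCLM_apply_apply (hasTemperateGrowth_phase z) _ x

theorem coeFn_incl (f : 𝓢(ℝ, ℂ)) : incl f =ᵐ[volume] f := SchwartzMap.coeFn_toLp f 2 volume

theorem denseRange_incl : DenseRange incl :=
  SchwartzMap.denseRange_toLpCLM (F := ℂ) (E := ℝ) (p := 2) (by simp) (μ := volume)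

theorem displacement_incl (z : ℝ × ℝ) (f : 𝓢(ℝ, ℂ)) :
    displacement z (incl f) = incl (schwartzDisplacement z f) := by
  refine Lp.ext ?_
  filter_upwards [coeFn_displacement z (incl f), coeFn_incl (schwartzDisplacement z f),
    (measurePreserving_sub_right volume z.1).quasiMeasurePreserving.ae (coeFn_incl f)]
    with x hdisp hincl hf
  rw [hdisp, hincl, hf, schwartzDisplacement_apply]

end Displacement

section Generators

open MeasureTheory Filter

theorem incl_mem_domain (T : 𝓢(ℝ, ℂ) →ₗ[ℂ] 𝓢(ℝ, ℂ)) (f : 𝓢(ℝ, ℂ)) :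
    incl f ∈ (schwartzOp T).domain := ⟨f, rfl⟩

theorem schwartzOp_incl (T : 𝓢(ℝ, ℂ) →ₗ[ℂ] 𝓢(ℝ, ℂ)) (f : 𝓢(ℝ, ℂ)) :
    schwartzOp T ⟨incl f, incl_mem_domain T f⟩ = incl (T f) := by
  change incl (T ((LinearEquiv.ofInjective incl incl_injective).symm ⟨incl f, _⟩)) = _
  congr 2
  exact (LinearEquiv.ofInjective incl incl_injective).symm_apply_apply f

theorem dense_domain_schwartzOp (T : 𝓢(ℝ, ℂ) →ₗ[ℂ] 𝓢(ℝ, ℂ)) :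
    Dense ((schwartzOp T).domain : Set H) := denseRange_incl

theorem schwartzOp_le {T : 𝓢(ℝ, ℂ) →ₗ[ℂ] 𝓢(ℝ, ℂ)} {A : H →ₗ.[ℂ] H}
    (h : ∀ f, (incl f, incl (T f)) ∈ A.graph) : schwartzOp T ≤ A := by
  refine LinearPMap.le_of_le_graph ?_
  rintro ⟨ψ, φ⟩ hφ
  obtain ⟨⟨_, f, rfl⟩, rfl, rfl⟩ := (LinearPMap.mem_graph_iff _).1 hφ
  exact schwartzOp_incl T f ▸ h f

/-- `c x - i s d/dx` on the Schwartz space, the core of `c Q + s P`. -/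
def linComb (c s : ℝ) : 𝓢(ℝ, ℂ) →ₗ[ℂ] 𝓢(ℝ, ℂ) := (c : ℂ) • mulX + (s : ℂ) • negIDeriv

theorem linComb_apply (c s : ℝ) (f : 𝓢(ℝ, ℂ)) (x : ℝ) :
    linComb c s f x = c * (x * f x) - s * Complex.I * deriv f x := by
  change c * mulX f x + s * (-Complex.I * SchwartzMap.derivCLM ℂ ℂ f x) = _
  rw [mulX_apply, SchwartzMap.derivCLM_apply]
  ring

/-- The line in phase space along which the displacements form the unitary group generated by
`c Q + s P`. -/
def ray (c s t : ℝ) : ℝ × ℝ := (-(s * t), c * t)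

theorem ray_zero (c s : ℝ) : ray c s 0 = 0 := by simp [ray]

theorem ray_add (c s t u : ℝ) : ray c s (t + u) = ray c s t + ray c s u := by
  ext <;> simp only [ray, Prod.fst_add, Prod.snd_add] <;> ring

theorem continuous_ray (c s : ℝ) : Continuous (ray c s) := by unfold ray; fun_prop

theorem hasDerivAt_phase_ray (c s x t : ℝ) :
    HasDerivAt (fun t => (phase (ray c s t) x : ℂ))
      (phase (ray c s t) x * (Complex.I * (c * (x + s * t)))) t := by
  have hphase : ∀ t, (phase (ray c s t) x : ℂ) =
      Complex.exp (Complex.I * (c * x * t + s * c / 2 * (t : ℂ) ^ 2)) := fun t => by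
    rw [phase_apply, ray]
    push_cast
    ring_nf
  have ht : HasDerivAt (fun t : ℝ => (t : ℂ)) 1 t := Complex.ofRealCLM.hasDerivAt
  rw [funext hphase, hphase t]
  refine (((ht.const_mul (c * x : ℂ)).fun_add
    ((ht.fun_pow 2).const_mul (s * c / 2 : ℂ))).const_mul Complex.I).cexp.congr_deriv ?_
  push_cast
  ring

theorem hasDerivAt_schwartzDisplacement_ray (c s x : ℝ) (f : 𝓢(ℝ, ℂ)) (t : ℝ) :
    HasDerivAt (fun t => schwartzDisplacement (ray c s t) f x)
      (Complex.I * schwartzDisplacement (ray c s t) (linComb c s f) x) t := by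
  have htranslate : HasDerivAt (fun t => f (x - (ray c s t).1))
      (s * deriv f (x - (ray c s t).1)) t := by
    have hshift : HasDerivAt (fun t => x - (ray c s t).1) s t := by
      simpa [ray] using (hasDerivAt_id t).const_mul s |>.const_add x
    exact (f.differentiableAt.hasDerivAt.scomp t hshift).congr_deriv (Complex.coe_smul _ _).symm
  have hx : ((x - (ray c s t).1 : ℝ) : ℂ) = x + s * t := by simp [ray]
  simp only [schwartzDisplacement_apply]
  refine ((hasDerivAt_phase_ray c s x t).fun_mul htranslate).congr_deriv ?_
  rw [linComb_apply, hx]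
  linear_combination (phase (ray c s t) x * s * deriv f (x - (ray c s t).1)) * Complex.I_sq

theorem norm_schwartzDisplacement_le (z : ℝ × ℝ) (f : 𝓢(ℝ, ℂ)) (x : ℝ) :
    ‖schwartzDisplacement z f x‖ ≤ SchwartzMap.seminorm ℂ 0 0 f := by
  rw [schwartzDisplacement_apply, norm_mul, Circle.norm_coe, one_mul]
  exact f.norm_le_seminorm ℂ _

theorem inner_incl (f g : 𝓢(ℝ, ℂ)) :
    ⟪incl f, incl g⟫_ℂ = ∫ x, ⟪f x, g x⟫_ℂ := by
  rw [L2.inner_def]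
  refine integral_congr_ae ?_
  filter_upwards [coeFn_incl f, coeFn_incl g] with x hf hg
  rw [hf, hg]

theorem hasDerivAt_inner_displacement_ray (c s : ℝ) (f g : 𝓢(ℝ, ℂ)) (t : ℝ) :
    HasDerivAt (fun t => ⟪incl g, displacement (ray c s t) (incl f)⟫_ℂ)
      ⟪incl g, displacement (ray c s t) (Complex.I • incl (linComb c s f))⟫_ℂ t := by
  have hint : ∀ h k : 𝓢(ℝ, ℂ), Integrable fun x => ⟪h x, k x⟫_ℂ := fun h k =>
    (L2.integrable_inner (incl h) (incl k)).congr <| by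
      filter_upwards [coeFn_incl h, coeFn_incl k] with x hh hk
      rw [hh, hk]
  let C := SchwartzMap.seminorm ℂ 0 0 (linComb c s f)
  have hderiv := hasDerivAt_integral_of_dominated_loc_of_deriv_le (μ := volume) (x₀ := t)
    (F := fun t x => ⟪g x, schwartzDisplacement (ray c s t) f x⟫_ℂ)
    (F' := fun t x => ⟪g x, Complex.I * schwartzDisplacement (ray c s t) (linComb c s f) x⟫_ℂ)
    (bound := fun x => ‖g x‖ * C) univ_mem
    (.of_forall fun t => (hint _ _).1) (hint _ _) ?_ (ae_of_all _ fun x t _ => ?_)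
    (g.integrable.norm.mul_const C)
    (ae_of_all _ fun x t _ => ?_)
  · simpa only [_root_.map_smul, displacement_incl, inner_smul_right, inner_incl, ← smul_eq_mul,
      integral_smul] using hderiv.2
  · simpa only [← smul_eq_mul, inner_smul_right] using ((hint _ _).const_mul Complex.I).1
  · refine (norm_inner_le_norm _ _).trans (mul_le_mul_of_nonneg_left ?_ (norm_nonneg _))
    rw [norm_mul, Complex.norm_I, one_mul]
    exact norm_schwartzDisplacement_le _ _ _
  · simpa using (hasDerivAt_const t (g x)).inner ℂ
      (hasDerivAt_schwartzDisplacement_ray c s x f t)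

theorem hasDerivAt_displacement_ray (c s : ℝ) (f : 𝓢(ℝ, ℂ)) (t : ℝ) :
    HasDerivAt (fun t => displacement (ray c s t) (incl f))
      (displacement (ray c s t) (Complex.I • incl (linComb c s f))) t := by
  refine hasDerivAt_of_hasDerivAt_inner denseRange_incl
    ((continuous_displacement _).comp (continuous_ray c s)) ?_ t
  rintro _ ⟨g, rfl⟩ t
  exact hasDerivAt_inner_displacement_ray c s f g t

theorem displacement_ray_add (c s t u : ℝ) :
    displacement (ray c s (t + u)) = displacement (ray c s t) * displacement (ray c s u) := by
  rw [ray_add, displacement_add, weylMultiplier_of_parallel (by simp only [ray]; ring), one_smul]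

theorem isUnitaryGroupOf_displacement_ray (c s : ℝ) :
    IsUnitaryGroupOf (generator fun t => displacement (ray c s t))
      fun t => displacement (ray c s t) :=
  isUnitaryGroupOf_generator (fun _ => displacement_mem_unitary _)
    (by simp only [ray_zero, displacement_zero]) (displacement_ray_add c s)
    fun ψ => (continuous_displacement ψ).comp (continuous_ray c s)

theorem schwartzOp_linComb_le_generator (c s : ℝ) :
    schwartzOp (linComb c s) ≤ generator fun t => displacement (ray c s t) := by
  refine schwartzOp_le fun f => ?_
  refine mem_graph_generator.2 ((hasDerivAt_displacement_ray c s f 0).congr_deriv ?_)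
  rw [ray_zero, displacement_zero, one_apply_eq_self]

theorem isSelfAdjoint_and_isUnitaryGroupOf_linComb (c s : ℝ) :
    IsSelfAdjoint (schwartzOp (linComb c s)).closure ∧
      IsUnitaryGroupOf (schwartzOp (linComb c s)).closure fun t => displacement (ray c s t) := by
  have hgroup := isUnitaryGroupOf_displacement_ray c s
  obtain ⟨hsa, hclosure⟩ := hgroup.isSelfAdjoint_and_closure_eq
    (dense_domain_schwartzOp (linComb c s)) (schwartzOp_linComb_le_generator c s) <| by
      rintro t _ ⟨f, rfl⟩
      exact ⟨_, (displacement_incl _ f).symm⟩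
  rw [hclosure]
  exact ⟨hsa, hgroup⟩

theorem expI_linComb (c s t : ℝ) :
    expI (schwartzOp (linComb c s)).closure t = displacement (ray c s t) := by
  obtain ⟨hsa, hgroup⟩ := isSelfAdjoint_and_isUnitaryGroupOf_linComb c s
  rw [expI_eq hsa.dense_domain hgroup]

theorem isSelfAdjoint_and_isUnitaryGroupOf_expI_linComb (c s : ℝ) :
    IsSelfAdjoint (schwartzOp (linComb c s)).closure ∧
      IsUnitaryGroupOf (schwartzOp (linComb c s)).closure
        (expI (schwartzOp (linComb c s)).closure) := by
  rw [funext (expI_linComb c s)]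
  exact isSelfAdjoint_and_isUnitaryGroupOf_linComb c s

theorem position_eq_linComb : position = (schwartzOp (linComb 1 0)).closure := by
  simp [position, linComb]

theorem momentum_eq_linComb : momentum = (schwartzOp (linComb 0 1)).closure := by
  simp [momentum, linComb]

theorem weyl_eq_displacement : weyl = displacement := by
  funext z
  have hz : z = ray 0 1 (-z.1) + ray 1 0 z.2 := by ext <;> simp [ray]
  conv_rhs => rw [hz]
  rw [weyl, position_eq_linComb, momentum_eq_linComb, expI_linComb, expI_linComb, displacement_add]
  congr 1
  simp [weylMultiplier, ray]

end Generators

section LinearPMapAlgebra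

open LinearPMap

theorem add_mem_graph {R E F : Type*} [Ring R] [AddCommGroup E] [Module R E] [AddCommGroup F]
    [Module R F] {A B : E →ₗ.[R] F} {x : E} {y z : F} (hA : (x, y) ∈ A.graph)
    (hB : (x, z) ∈ B.graph) : (x, y + z) ∈ (A + B).graph := by
  obtain ⟨⟨_, hxA⟩, rfl, rfl⟩ := (mem_graph_iff _).1 hA
  obtain ⟨⟨_, hxB⟩, rfl, rfl⟩ := (mem_graph_iff _).1 hB
  exact (A + B).mem_graph ⟨_, hxA, hxB⟩

theorem smul_mem_graph {R E F : Type*} [CommRing R] [AddCommGroup E] [Module R E] [AddCommGroup F]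
    [Module R F] {A : E →ₗ.[R] F} {x : E} {y : F} (c : R) (hA : (x, y) ∈ A.graph) :
    (x, c • y) ∈ (c • A).graph := by
  obtain ⟨x, rfl, rfl⟩ := (mem_graph_iff _).1 hA
  exact (c • A).mem_graph x

variable {𝕜 E F : Type*} [RCLike 𝕜] [NormedAddCommGroup E] [InnerProductSpace 𝕜 E]
  [NormedAddCommGroup F] [InnerProductSpace 𝕜 F] {A A' : E →ₗ.[𝕜] F} {B B' : F →ₗ.[𝕜] E}

theorem isFormalAdjoint_add (h : A.IsFormalAdjoint B) (h' : A'.IsFormalAdjoint B') :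
    (A + A').IsFormalAdjoint (B + B') := fun x y => by
  rw [LinearPMap.add_apply, LinearPMap.add_apply, inner_add_left, inner_add_right,
    h ⟨x, x.2.1⟩ ⟨y, y.2.1⟩, h' ⟨x, x.2.2⟩ ⟨y, y.2.2⟩]

theorem isFormalAdjoint_smul (h : A.IsFormalAdjoint B) (c : 𝕜) :
    (c • A).IsFormalAdjoint (starRingEnd 𝕜 c • B) := fun x y => by
  rw [LinearPMap.smul_apply, LinearPMap.smul_apply, inner_smul_left, inner_smul_right, h]

theorem isFormalAdjoint_of_isSelfAdjoint [CompleteSpace E] {S : E →ₗ.[𝕜] E}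
    (hS : IsSelfAdjoint S) : S.IsFormalAdjoint S := by
  simpa only [isSelfAdjoint_def.1 hS] using adjoint_isFormalAdjoint hS.dense_domain

end LinearPMapAlgebra

section Quadrature

open LinearPMap

theorem incl_mem_graph_closure (T : 𝓢(ℝ, ℂ) →ₗ[ℂ] 𝓢(ℝ, ℂ)) (f : 𝓢(ℝ, ℂ)) :
    (incl f, incl (T f)) ∈ (schwartzOp T).closure.graph :=
  schwartzOp_incl T f ▸ le_graph_of_le (schwartzOp T).le_closure
    (mem_graph _ ⟨incl f, incl_mem_domain T f⟩)

/-- The creation operator `(Q - iP) / √2`, on the intersection of the domains of `Q` and `P`; it is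
contained in the adjoint of the annihilation operator. -/
def creation : H →ₗ.[ℂ] H := ((√2 : ℝ) : ℂ)⁻¹ • (position + (-Complex.I) • momentum)

theorem incl_mem_graph_annihilation (f : 𝓢(ℝ, ℂ)) :
    (incl f, ((√2 : ℝ) : ℂ)⁻¹ • (incl (mulX f) + Complex.I • incl (negIDeriv f))) ∈
      annihilation.graph :=
  smul_mem_graph _ (add_mem_graph (incl_mem_graph_closure _ f)
    (smul_mem_graph _ (incl_mem_graph_closure _ f)))

theorem incl_mem_graph_creation (f : 𝓢(ℝ, ℂ)) :
    (incl f, ((√2 : ℝ) : ℂ)⁻¹ • (incl (mulX f) + (-Complex.I) • incl (negIDeriv f))) ∈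
      creation.graph :=
  smul_mem_graph _ (add_mem_graph (incl_mem_graph_closure _ f)
    (smul_mem_graph _ (incl_mem_graph_closure _ f)))

theorem dense_domain_annihilation : Dense (annihilation.domain : Set H) :=
  denseRange_incl.mono <| by
    rintro _ ⟨f, rfl⟩
    exact mem_domain_of_mem_graph (incl_mem_graph_annihilation f)

theorem isFormalAdjoint_annihilation_creation : annihilation.IsFormalAdjoint creation := by
  have hQ : position.IsFormalAdjoint position := isFormalAdjoint_of_isSelfAdjoint
    (position_eq_linComb ▸ (isSelfAdjoint_and_isUnitaryGroupOf_linComb 1 0).1)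
  have hP : momentum.IsFormalAdjoint momentum := isFormalAdjoint_of_isSelfAdjoint
    (momentum_eq_linComb ▸ (isSelfAdjoint_and_isUnitaryGroupOf_linComb 0 1).1)
  simpa [annihilation, creation] using isFormalAdjoint_smul
    (isFormalAdjoint_add hQ (isFormalAdjoint_smul hP Complex.I)) ((√2 : ℝ) : ℂ)⁻¹

theorem creation_le_adjoint_annihilation : creation ≤ annihilation.adjoint :=
  isFormalAdjoint_annihilation_creation.le_adjoint dense_domain_annihilation

/-- The operator `(e^{iθ} a* + e^{-iθ} a) / √2` whose closure is `Q_θ`. -/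
def preQuadrature (θ : ℝ) : H →ₗ.[ℂ] H :=
  ((√2 : ℝ) : ℂ)⁻¹ • (Complex.exp (Complex.I * θ) • annihilation.adjoint +
    Complex.exp (-(Complex.I * θ)) • annihilation)

theorem isFormalAdjoint_preQuadrature (θ : ℝ) :
    (preQuadrature θ).IsFormalAdjoint (preQuadrature θ) := by
  have hadj := adjoint_isFormalAdjoint dense_domain_annihilation
  simpa [preQuadrature, ← Complex.exp_conj, add_comm] using isFormalAdjoint_smul
    (isFormalAdjoint_add (isFormalAdjoint_smul hadj (Complex.exp (Complex.I * θ)))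
      (isFormalAdjoint_smul hadj.symm (Complex.exp (-(Complex.I * θ))))) ((√2 : ℝ) : ℂ)⁻¹

theorem schwartzOp_linComb_le_preQuadrature (θ : ℝ) :
    schwartzOp (linComb (Real.cos θ) (Real.sin θ)) ≤ preQuadrature θ := by
  refine schwartzOp_le fun f => ?_
  have hgraph : (incl f, _) ∈ (preQuadrature θ).graph := smul_mem_graph ((√2 : ℝ) : ℂ)⁻¹
    (add_mem_graph
      (smul_mem_graph (Complex.exp (Complex.I * θ))
        (le_graph_of_le creation_le_adjoint_annihilation (incl_mem_graph_creation f)))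
      (smul_mem_graph (Complex.exp (-(Complex.I * θ))) (incl_mem_graph_annihilation f)))
  convert hgraph using 2
  have hlin : incl (linComb (Real.cos θ) (Real.sin θ) f) =
      (Real.cos θ : ℂ) • incl (mulX f) + (Real.sin θ : ℂ) • incl (negIDeriv f) := by
    simp only [linComb, LinearMap.add_apply, LinearMap.smul_apply, _root_.map_add,
      _root_.map_smul]
  have hsqrt : ((√2 : ℝ) : ℂ)⁻¹ * ((√2 : ℝ) : ℂ)⁻¹ = 1 / 2 := by
    rw [← mul_inv, ← Complex.ofReal_mul, Real.mul_self_sqrt (by norm_num)]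
    norm_num
  rw [hlin, Complex.ofReal_cos, Complex.ofReal_sin, mul_comm, Complex.exp_mul_I, ← neg_mul,
    Complex.exp_mul_I, Complex.cos_neg, Complex.sin_neg]
  match_scalars
  · linear_combination (-2 * Complex.cos θ) * hsqrt
  · linear_combination (2 * Complex.sin θ * Complex.I ^ 2) * hsqrt + Complex.sin θ * Complex.I_sq

theorem quadrature_eq_linComb (θ : ℝ) :
    quadrature θ = (schwartzOp (linComb (Real.cos θ) (Real.sin θ))).closure :=
  closure_eq_of_le_of_isFormalAdjoint (dense_domain_schwartzOp _)
    (isSelfAdjoint_and_isUnitaryGroupOf_linComb _ _).1 (schwartzOp_linComb_le_preQuadrature θ)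
    (isFormalAdjoint_preQuadrature θ)

end Quadrature

section FourierInjective

open MeasureTheory
open scoped FourierTransform

theorem ae_eq_zero_of_fourier_eq_zero {V F : Type*} [NormedAddCommGroup V] [InnerProductSpace ℝ V]
    [FiniteDimensional ℝ V] [MeasurableSpace V] [BorelSpace V] [NormedAddCommGroup F]
    [NormedSpace ℂ F] [CompleteSpace F] {h : V → F} (hh : Integrable h) (h0 : 𝓕 h = 0) :
    h =ᵐ[volume] 0 := by
  refine ae_eq_zero_of_integral_contDiff_smul_eq_zero hh.locallyIntegrable fun g hg hgc => ?_
  have hgc' : HasCompactSupport fun x => (g x : ℂ) := hgc.comp_left Complex.ofReal_zero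
  let G : 𝓢(V, ℂ) := hgc'.toSchwartzMap (Complex.ofRealCLM.contDiff.comp hg)
  let K : 𝓢(V, ℂ) := 𝓕⁻ G
  have hK : 𝓕 (K : V → ℂ) = fun x => (g x : ℂ) := by
    rw [← SchwartzMap.fourier_coe, FourierTransform.fourier_fourierInv_eq]
    rfl
  have hflip : ∫ ξ, 𝓕 (K : V → ℂ) ξ • h ξ = ∫ x, K x • 𝓕 h x := by
    have hself := VectorFourier.integral_fourierIntegral_smul_eq_flip (L := innerₗ V)
      (μ := volume) (ν := volume) Real.continuous_fourierChar continuous_inner K.integrable hh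
    rwa [flip_innerₗ] at hself
  simpa [hK, h0] using hflip

end FourierInjective

section Irreducible

open MeasureTheory
open scoped FourierTransform

theorem ae_eq_zero_or_of_forall_mul_shift {G : Type*} [AddGroup G] [MeasurableSpace G]
    [MeasurableAdd₂ G] [MeasurableNeg G] {μ : Measure G} [SFinite μ] [μ.IsAddLeftInvariant]
    [μ.IsNegInvariant] {f g : G → ENNReal} (hf : Measurable f) (hg : Measurable g)
    (h : ∀ q, (fun x => f x * g (x - q)) =ᵐ[μ] 0) : f =ᵐ[μ] 0 ∨ g =ᵐ[μ] 0 := by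
  rw [← lintegral_eq_zero_iff hf, ← lintegral_eq_zero_iff hg, ← mul_eq_zero]
  calc (∫⁻ x, f x ∂μ) * ∫⁻ y, g y ∂μ
      = ∫⁻ x, ∫⁻ q, f x * g (x - q) ∂μ ∂μ := by
        rw [← lintegral_mul_const _ hf]
        refine lintegral_congr fun x => ?_
        have hgx : Measurable fun q => g (x - q) := hg.comp (measurable_const.sub measurable_id)
        rw [lintegral_const_mul _ hgx, lintegral_sub_left_eq_self g x]
    _ = ∫⁻ q, ∫⁻ x, f x * g (x - q) ∂μ ∂μ := lintegral_lintegral_swap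
        ((hf.comp measurable_fst).mul
          (hg.comp (measurable_fst.sub measurable_snd))).aemeasurable
    _ = 0 := by simp only [lintegral_congr_ae (h _), Pi.zero_apply, lintegral_zero]

theorem inner_displacement_eq_fourier (φ ψ : H) (q ξ : ℝ) :
    ⟪φ, displacement (q, -(2 * Real.pi * ξ)) ψ⟫_ℂ =
      Complex.exp (Complex.I * (q * (Real.pi * ξ))) *
        𝓕 (fun x => starRingEnd ℂ (φ x) * ψ (x - q)) ξ := by
  rw [L2.inner_def, Real.fourier_real_eq, ← integral_const_mul]
  refine integral_congr_ae ?_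
  filter_upwards [coeFn_displacement (q, -(2 * Real.pi * ξ)) ψ] with x hx
  have hphase : (phase (q, -(2 * Real.pi * ξ)) x : ℂ) =
      Complex.exp (Complex.I * (q * (Real.pi * ξ))) * Real.fourierChar (-(x * ξ)) := by
    rw [phase_apply, Real.fourierChar_apply, ← Complex.exp_add]
    push_cast
    ring_nf
  rw [hx, RCLike.inner_apply', Circle.smul_def, smul_eq_mul, hphase]
  ring

theorem eq_zero_or_of_inner_displacement_eq_zero {φ ψ : H}
    (h : ∀ z, ⟪φ, displacement z ψ⟫_ℂ = 0) : φ = 0 ∨ ψ = 0 := by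
  have hshift : ∀ q, (fun x => ‖φ x‖ₑ * ‖ψ (x - q)‖ₑ) =ᵐ[volume] 0 := by
    intro q
    have hint : Integrable fun x => starRingEnd ℂ (φ x) * ψ (x - q) :=
      (Lp.memLp φ).star.integrable_mul (q := 2)
        ((Lp.memLp ψ).comp_measurePreserving (measurePreserving_sub_right volume q))
    have hfourier : 𝓕 (fun x => starRingEnd ℂ (φ x) * ψ (x - q)) = 0 := by
      funext ξ
      refine (mul_eq_zero.1 ?_).resolve_left (Complex.exp_ne_zero (Complex.I * (q * (Real.pi * ξ))))
      rw [← inner_displacement_eq_fourier, h]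
    filter_upwards [ae_eq_zero_of_fourier_eq_zero hint hfourier] with x hx
    simpa using hx
  refine (ae_eq_zero_or_of_forall_mul_shift (Lp.stronglyMeasurable φ).measurable.enorm
    (Lp.stronglyMeasurable ψ).measurable.enorm hshift).imp ?_ ?_ <;>
  · intro hzero
    refine (Lp.eq_zero_iff_ae_eq_zero).2 ?_
    filter_upwards [hzero] with x hx
    simpa using hx

theorem nontrivial_H : Nontrivial H := by
  refine ⟨indicatorConstLp 2 (measurableSet_Icc (a := (0 : ℝ)) (b := 1)) (by simp) (1 : ℂ), 0,
    norm_ne_zero_iff.1 ?_⟩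
  rw [norm_indicatorConstLp (by simp) (by simp)]
  simp

theorem isIrreducible_displacement : IsIrreducible displacement := by
  refine ⟨nontrivial_H, fun K hK hinv => or_iff_not_imp_left.2 fun hne => ?_⟩
  obtain ⟨ψ, hψ, hψ0⟩ := Submodule.exists_mem_ne_zero_of_ne_bot hne
  have : CompleteSpace K := hK.completeSpace_coe
  refine (Submodule.orthogonal_eq_bot_iff).1 ((Submodule.eq_bot_iff _).2 fun φ hφ => ?_)
  exact (eq_zero_or_of_inner_displacement_eq_zero fun z =>
    (Submodule.mem_orthogonal' K φ).1 hφ _ (hinv z ψ hψ)).resolve_right hψ0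

end Irreducible

section ProjectiveRep

variable {G G' : Type*} {E : Type*} [NormedAddCommGroup E] [InnerProductSpace ℂ E]

theorem IsIrreducible.comp_surjective {U : G → E →L[ℂ] E} (hU : IsIrreducible U) {f : G' → G}
    (hf : Function.Surjective f) : IsIrreducible fun x => U (f x) :=
  ⟨hU.1, fun K hK hinv => hU.2 K hK (hf.forall.2 hinv)⟩

theorem UnitarilyEquivalent.upToPhase {U₁ U₂ : G → E →L[ℂ] E} (h : UnitarilyEquivalent U₁ U₂) :
    UnitarilyEquivalentUpToPhase U₁ U₂ := by
  obtain ⟨V, hV⟩ := h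
  exact ⟨V, 1, fun _ => norm_one, fun x ψ => by rw [hV, Pi.one_apply, one_smul]⟩

variable [AddCommGroup G] [TopologicalSpace G] [AddCommGroup G'] [TopologicalSpace G']
  [CompleteSpace E] {m m₁ m₂ : G → G → ℂ} {U U₁ U₂ : G → E →L[ℂ] E}

theorem IsProjectiveUnitaryRep.comp (hU : IsProjectiveUnitaryRep m U) (f : G' →ₜ+ G) :
    IsProjectiveUnitaryRep (fun x y => m (f x) (f y)) fun x => U (f x) where
  unitary x := hU.unitary _
  norm_multiplier x y := hU.norm_multiplier _ _
  add x y := by rw [map_add, hU.add]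
  continuous ψ := (hU.continuous ψ).comp f.continuous_toFun

theorem IsProjectiveUnitaryRep.apply_ne_zero (hU : IsProjectiveUnitaryRep m U) (x : G) {ψ : E}
    (hψ : ψ ≠ 0) : U x ψ ≠ 0 := by
  rwa [← norm_ne_zero_iff, ContinuousLinearMap.norm_map_of_mem_unitary (hU.unitary x),
    norm_ne_zero_iff]

theorem IsProjectiveUnitaryRep.smul_apply_apply_comm (hU : IsProjectiveUnitaryRep m U) (x y : G)
    (ψ : E) : m x y • U x (U y ψ) = m y x • U y (U x ψ) := by
  have hcomm := congrArg (· ψ) ((hU.add x y).symm.trans (add_comm x y ▸ hU.add y x))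
  exact hcomm

-- `U x` and `U y` commute up to the scalar `m y x / m x y`, and such scalar commutators are
-- preserved by phases and by intertwiners.
theorem UnitarilyEquivalentUpToPhase.multiplier_mul_eq [Nontrivial E]
    (h : UnitarilyEquivalentUpToPhase U₁ U₂) (h₁ : IsProjectiveUnitaryRep m₁ U₁)
    (h₂ : IsProjectiveUnitaryRep m₂ U₂) (x y : G) : m₁ x y * m₂ y x = m₁ y x * m₂ x y := by
  obtain ⟨V, c, hc, hV⟩ := h
  obtain ⟨ψ, hψ⟩ := exists_ne (0 : E)
  have hcne : c x * c y ≠ 0 := norm_ne_zero_iff.1 (by simp [hc])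
  have hχ : U₂ y (U₂ x (V ψ)) ≠ 0 :=
    h₂.apply_ne_zero y (h₂.apply_ne_zero x (V.map_ne_zero_iff.2 hψ))
  have hcomm₁ : (m₁ x y * (c x * c y)) • U₂ x (U₂ y (V ψ)) =
      (m₁ y x * (c x * c y)) • U₂ y (U₂ x (V ψ)) := by
    have hV₁ := congrArg V (h₁.smul_apply_apply_comm x y ψ)
    simp only [map_smul, hV, smul_smul] at hV₁
    rwa [mul_comm (c y)] at hV₁
  have hcomm₂ := h₂.smul_apply_apply_comm x y (V ψ)
  refine mul_right_cancel₀ hcne (smul_left_injective ℂ hχ ?_)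
  calc (m₁ x y * m₂ y x * (c x * c y)) • U₂ y (U₂ x (V ψ))
      = (m₁ x y * (c x * c y)) • m₂ y x • U₂ y (U₂ x (V ψ)) := by rw [smul_smul]; ring_nf
    _ = m₂ x y • (m₁ x y * (c x * c y)) • U₂ x (U₂ y (V ψ)) := by rw [← hcomm₂, smul_comm]
    _ = (m₁ y x * m₂ x y * (c x * c y)) • U₂ y (U₂ x (V ψ)) := by
      rw [hcomm₁, smul_smul]; ring_nf

end ProjectiveRep

section Tilt

/-- The inverse of `tilt θ`, when `sin θ ≠ 0`. -/
def untilt (θ : ℝ) : ℝ × ℝ →L[ℝ] ℝ × ℝ :=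
  (ContinuousLinearMap.fst ℝ ℝ ℝ).prod
    ((Real.sin θ)⁻¹ •
      (ContinuousLinearMap.snd ℝ ℝ ℝ - Real.cos θ • ContinuousLinearMap.fst ℝ ℝ ℝ))

theorem untilt_apply (θ : ℝ) (z : ℝ × ℝ) :
    untilt θ z = (z.1, (z.2 - z.1 * Real.cos θ) / Real.sin θ) := by
  simp [untilt, div_eq_inv_mul, mul_comm z.1]

theorem leftInverse_untilt {θ : ℝ} (hs : Real.sin θ ≠ 0) :
    Function.LeftInverse (untilt θ) (tilt θ) := fun z => by
  rw [untilt_apply]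
  simp [tilt, hs]

theorem rightInverse_untilt {θ : ℝ} (hs : Real.sin θ ≠ 0) :
    Function.RightInverse (untilt θ) (tilt θ) := fun z => by
  rw [untilt_apply]
  simp [tilt, hs]

theorem bijective_tilt {θ : ℝ} (hs : Real.sin θ ≠ 0) : Function.Bijective (tilt θ) :=
  ⟨(leftInverse_untilt hs).injective, (rightInverse_untilt hs).surjective⟩

theorem tiltedWeyl_eq_displacement_untilt {θ : ℝ} (hs : Real.sin θ ≠ 0) :
    tiltedWeyl θ = fun z => displacement (untilt θ z) := by
  funext z
  rw [tiltedWeyl, weyl_eq_displacement, ← leftInverse_untilt hs (Function.invFun (tilt θ) z),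
    Function.rightInverse_invFun (bijective_tilt hs).2 z]

theorem tiltedMultiplier_eq_weylMultiplier_untilt {θ : ℝ} (hs : Real.sin θ ≠ 0) :
    tiltedMultiplier θ = fun z w => weylMultiplier (untilt θ z) (untilt θ w) := by
  have hs' : (Real.sin θ : ℂ) ≠ 0 := by exact_mod_cast hs
  funext z w
  simp only [weylMultiplier, tiltedMultiplier, untilt_apply]
  congr 2
  push_cast [-Complex.ofReal_sin, -Complex.ofReal_cos]
  field_simp
  ring

theorem isProjectiveUnitaryRep_tiltedWeyl {θ : ℝ} (hs : Real.sin θ ≠ 0) :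
    IsProjectiveUnitaryRep (tiltedMultiplier θ) (tiltedWeyl θ) := by
  rw [tiltedMultiplier_eq_weylMultiplier_untilt hs, tiltedWeyl_eq_displacement_untilt hs]
  exact isProjectiveUnitaryRep_displacement.comp (untilt θ : ℝ × ℝ →ₜ+ ℝ × ℝ)

theorem isIrreducible_tiltedWeyl {θ : ℝ} (hs : Real.sin θ ≠ 0) :
    IsIrreducible (tiltedWeyl θ) := by
  rw [tiltedWeyl_eq_displacement_untilt hs]
  exact isIrreducible_displacement.comp_surjective (leftInverse_untilt hs).surjective

theorem untilt_eq_ray_add_ray {θ : ℝ} (hs : Real.sin θ ≠ 0) (q p : ℝ) :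
    untilt θ (q, p) = ray (Real.cos θ) (Real.sin θ) (-q / Real.sin θ) +
      ray 1 0 (p / Real.sin θ) := by
  rw [untilt_apply]
  ext <;> simp only [ray, Prod.fst_add, Prod.snd_add] <;> field_simp <;> ring

theorem tiltedWeyl_eq_smul_expI_mul_expI {θ : ℝ} (hs : Real.sin θ ≠ 0) (q p : ℝ) :
    tiltedWeyl θ (q, p) = Complex.exp (Complex.I * (q * p / (2 * Real.sin θ))) •
      (expI (quadrature θ) (-q / Real.sin θ) * expI position (p / Real.sin θ)) := by
  have hmultiplier : weylMultiplier (ray (Real.cos θ) (Real.sin θ) (-q / Real.sin θ))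
      (ray 1 0 (p / Real.sin θ)) = Complex.exp (Complex.I * (q * p / (2 * Real.sin θ))) := by
    have hs' : (Real.sin θ : ℂ) ≠ 0 := by exact_mod_cast hs
    simp only [weylMultiplier, ray]
    congr 2
    push_cast [-Complex.ofReal_sin, -Complex.ofReal_cos]
    field_simp
    ring
  rw [congrFun (tiltedWeyl_eq_displacement_untilt hs) (q, p), untilt_eq_ray_add_ray hs,
    displacement_add, hmultiplier, quadrature_eq_linComb, position_eq_linComb, expI_linComb,
    expI_linComb]

theorem eq_zero_of_forall_exp_mul_I_eq_one {a : ℝ}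
    (h : ∀ t : ℝ, Complex.exp ((t * a : ℝ) * Complex.I) = 1) : a = 0 := by
  by_contra ha
  have hpi := h (Real.pi / a)
  rw [div_mul_cancel₀ _ ha, Complex.exp_pi_mul_I] at hpi
  norm_num at hpi

theorem sin_eq_one_of_equivalent {θ : ℝ} (hs : Real.sin θ ≠ 0)
    (h : UnitarilyEquivalentUpToPhase weyl (tiltedWeyl θ)) : Real.sin θ = 1 := by
  have := nontrivial_H
  have hone : ∀ t : ℝ, Complex.exp ((t * (1 - (Real.sin θ)⁻¹) : ℝ) * Complex.I) = 1 := by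
    intro t
    have hmul := h.multiplier_mul_eq (weyl_eq_displacement ▸ isProjectiveUnitaryRep_displacement)
      (isProjectiveUnitaryRep_tiltedWeyl hs) (1, 0) (0, t)
    simp only [weylMultiplier, tiltedMultiplier, ← Complex.exp_add] at hmul
    rw [← div_eq_one_iff_eq (Complex.exp_ne_zero _), ← Complex.exp_sub] at hmul
    rw [← hmul]
    congr 1
    push_cast
    ring
  have hzero := eq_zero_of_forall_exp_mul_I_eq_one hone
  rwa [sub_eq_zero, eq_comm, inv_eq_one] at hzero

theorem tiltedWeyl_eq_weyl {θ : ℝ} (hs : Real.sin θ = 1) : tiltedWeyl θ = weyl := by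
  have hcos : Real.cos θ = 0 := by nlinarith [Real.sin_sq_add_cos_sq θ]
  rw [tiltedWeyl_eq_displacement_untilt (by simp [hs]), weyl_eq_displacement]
  funext z
  rw [untilt_apply, hs, hcos, mul_zero, sub_zero, div_one]

theorem equivalent_tfae {θ : ℝ} (hs : Real.sin θ ≠ 0) :
    [UnitarilyEquivalent weyl (tiltedWeyl θ), UnitarilyEquivalentUpToPhase weyl (tiltedWeyl θ),
      Real.sin θ = 1].TFAE := by
  tfae_have 1 → 2 := UnitarilyEquivalent.upToPhase
  tfae_have 2 → 3 := sin_eq_one_of_equivalent hs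
  tfae_have 3 → 1 := fun h => ⟨.refl ℂ H, fun z ψ => by rw [tiltedWeyl_eq_weyl h]; rfl⟩
  tfae_finish

theorem sin_ne_zero_of_mem {θ : ℝ} (hθ : θ ∈ Set.Ioo (-Real.pi) 0 ∪ Set.Ioo 0 Real.pi) :
    Real.sin θ ≠ 0 :=
  hθ.elim (fun h => (Real.sin_neg_of_neg_of_neg_pi_lt h.2 h.1).ne)
    fun h => (Real.sin_pos_of_pos_of_lt_pi h.1 h.2).ne'

theorem sin_eq_one_iff_of_mem {θ : ℝ} (hθ : θ ∈ Set.Ioo (-Real.pi) Real.pi) :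
    Real.sin θ = 1 ↔ θ = Real.pi / 2 := by
  have hpi := Real.pi_pos
  rw [← Real.cos_sub_pi_div_two, Real.cos_eq_one_iff_of_lt_of_lt (by linarith [hθ.1])
    (by linarith [hθ.2]), sub_eq_zero]

end Tilt

end TiltedWeyl

end

open TiltedWeyl in
theorem mainTheorem3 (θ : ℝ) (hθ : θ ∈ Set.Ioo (-Real.pi) 0 ∪ Set.Ioo 0 Real.pi) :
    -- `Q`, `P` and `Q_θ` are self-adjoint, the exponentials are the unitary groups they generate,
    -- and `Q = Q_0`
    (∀ A ∈ ({position, momentum, quadrature θ} : Set (H →ₗ.[ℂ] H)),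
      IsSelfAdjoint A ∧ IsUnitaryGroupOf A (expI A)) ∧
    quadrature 0 = position ∧
    -- `f_θ` is a linear bijection, so that `W_θ` is well defined
    Function.Bijective (tilt θ) ∧
    -- the explicit form of `W_θ`
    (∀ q p : ℝ, tiltedWeyl θ (q, p) =
      Complex.exp (Complex.I * (q * p / (2 * Real.sin θ))) •
        (expI (quadrature θ) (-q / Real.sin θ) * expI position (p / Real.sin θ))) ∧
    -- `W_θ` is an irreducible projective unitary representation with the stated multiplier
    IsProjectiveUnitaryRep (tiltedMultiplier θ) (tiltedWeyl θ) ∧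
    IsIrreducible (tiltedWeyl θ) ∧
    -- `W_θ` is unitarily equivalent to `W` only for `θ = π / 2`, even up to phases
    (UnitarilyEquivalent weyl (tiltedWeyl θ) ↔ θ = Real.pi / 2) ∧
    (UnitarilyEquivalentUpToPhase weyl (tiltedWeyl θ) ↔ θ = Real.pi / 2) := by
  have hs := sin_ne_zero_of_mem hθ
  have hsin : Real.sin θ = 1 ↔ θ = Real.pi / 2 :=
    sin_eq_one_iff_of_mem (hθ.elim (Set.Ioo_subset_Ioo_right Real.pi_pos.le ·)
      (Set.Ioo_subset_Ioo_left (neg_nonpos.2 Real.pi_pos.le) ·))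
  refine ⟨?_, ?_, bijective_tilt hs, tiltedWeyl_eq_smul_expI_mul_expI hs,
    isProjectiveUnitaryRep_tiltedWeyl hs, isIrreducible_tiltedWeyl hs,
    ((equivalent_tfae hs).out 0 2).trans hsin, ((equivalent_tfae hs).out 1 2).trans hsin⟩
  · simp only [Set.forall_mem_insert, Set.mem_singleton_iff, forall_eq, position_eq_linComb,
      momentum_eq_linComb, quadrature_eq_linComb]
    exact ⟨isSelfAdjoint_and_isUnitaryGroupOf_expI_linComb _ _,
      isSelfAdjoint_and_isUnitaryGroupOf_expI_linComb _ _,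
      isSelfAdjoint_and_isUnitaryGroupOf_expI_linComb _ _⟩
  · rw [quadrature_eq_linComb, position_eq_linComb, Real.cos_zero, Real.sin_zero]
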